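/- Let $G$ be a finite simple undirected graph with vertex set $[n]=\{1,\dots,n\}$ and edge set $E(G)$, let $\mathbb{K}$ be a field, and let $I(G)=\langle x_ix_j : \{i,j\}\in E(G)\rangle\subseteq \mathbb{K}[x_1,\dots,x_n]$ be its edge ideal. For $V\subseteq[n]$ put $m_V=\prod_{i\in V}x_i$. For an ideal $I$ of a Noetherian ring $R$ and $r\ge 0$, the $r$-th symbolic power is $I^{(r)}=(S^{-1}I^r)\cap R$, i.e. the preimage in $R$ of the extension of $I^r$ to $S^{-1}R$, where $S$ is the set of elements of $R$ lying in no minimal prime of $I$. The graph $G$ is called perfect if $\omega(G_V)=\chi(G_V)$ for every $V\subseteq[n]$, where $G_V$ is the subgraph induced on $V$, $\omega$ is the clique number and $\chi$ the chromatic number. Then $G$ is perfect if and only if for all integers $r\ge 0$ $$I(G)^{(r)}=\Big\langle \prod_{i=1}^{l} m_{V_i} \;:\; l\ge 0,\ V_1,\dots,V_l \text{ cliques of } G \text{ (not necessarily distinct) with } |V_i|\ge 2 \text{ and } \sum_{i=1}^{l}(|V_i|-1)=r\Big\rangle .$$ (For $r=0$ both sides are the unit ideal, the empty product being $1$.) 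-/

import Mathlib

/-- The elements of `R` lying in no minimal prime of `I`, as a multiplicative set. -/
def Ideal.minimalPrimesCompl {R : Type*} [CommRing R] (I : Ideal R) : Submonoid R where
  carrier := {s | ∀ P ∈ I.minimalPrimes, s ∉ P}
  one_mem' := fun P hP h => hP.1.1.ne_top ((Ideal.eq_top_iff_one P).mpr h)
  mul_mem' := fun {_ _} ha hb P hP h => (hP.1.1.mem_or_mem h).elim (ha P hP) (hb P hP)

/-- The `r`-th symbolic power `I^(r) = (S⁻¹ I^r) ∩ R`, where `S` is the complement of the union of
the minimal primes of `I`: extend `I^r` to `S⁻¹ R` and contract back to `R`. -/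
noncomputable def Ideal.symbolicPower {R : Type*} [CommRing R] (I : Ideal R) (r : ℕ) : Ideal R :=
  ((I ^ r).map (algebraMap R (Localization I.minimalPrimesCompl))).comap
    (algebraMap R (Localization I.minimalPrimesCompl))

/-- A graph is perfect if the clique number equals the chromatic number for every induced
subgraph. -/
def SimpleGraph.IsPerfect {V : Type*} (G : SimpleGraph V) : Prop :=
  ∀ W : Set V, ((G.induce W).cliqueNum : ℕ∞) = (G.induce W).chromaticNumber

/-- The edge ideal of `G`, generated by the monomials `x_i x_j` for the edges `{i, j}` of `G`. -/
noncomputable def SimpleGraph.edgeIdeal (K : Type*) [Field K] {V : Type*} (G : SimpleGraph V) :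
    Ideal (MvPolynomial V K) :=
  Ideal.span {m | ∃ i j : V, G.Adj i j ∧ m = MvPolynomial.X i * MvPolynomial.X j}

/-- The squarefree monomial `m_W`, the product of the variables `x_i` with `i ∈ W`. -/
noncomputable def setMonomial (K : Type*) [Field K] {V : Type*} (W : Finset V) :
    MvPolynomial V K :=
  ∏ i ∈ W, MvPolynomial.X i

/-- The ideal generated by the products `m_{V_1} ⋯ m_{V_l}` over all finite families (repetitions
allowed, the empty family included) of cliques of size at least two with `∑ (|V_i| - 1) = r`. -/
noncomputable def SimpleGraph.cliqueProductIdeal (K : Type*) [Field K] {V : Type*}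
    (G : SimpleGraph V) (r : ℕ) : Ideal (MvPolynomial V K) :=
  Ideal.span {m | ∃ F : Multiset (Finset V),
    (∀ W ∈ F, G.IsClique (W : Set V) ∧ 2 ≤ W.card) ∧
    (F.map fun W => W.card - 1).sum = r ∧
    m = (F.map (setMonomial K)).prod}

/-! Both ideals are monomial. A monomial `x^a` lies in `I(G)^(r)` iff every vertex cover has
`a`-weight at least `r`; taking complements, iff every independent set has weight at most `|a| - r`
(`le_sum_of_mem_symbolicPower`, `monomial_mem_symbolicPower`). It lies in the clique ideal iff `r ≤
|a|` and `a` is a sum of at most `|a| - r` clique indicators, since a clique `W` has degree `|W|`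
but contributes only `|W| - 1` to `r`. So equality for all `r` is a weighted min-max statement,
`IsWeightedCliquePerfect`. Lovász's weak perfect graph theorem identifies it with perfection:
replication passes from 0/1 weights to all weights, and an averaging argument passes to the
complement. -/

namespace SimpleGraph

/-! ### Weighted clique covers and the weak perfect graph theorem. -/

variable {V : Type*}

/-- The exponent vector of the squarefree monomial supported on `W`. -/
noncomputable def charFinsupp (W : Finset V) : V →₀ ℕ := ∑ i ∈ W, Finsupp.single i 1

theorem charFinsupp_apply [DecidableEq V] (W : Finset V) (v : V) :
    charFinsupp W v = if v ∈ W then 1 else 0 := by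
  simp [charFinsupp, Finsupp.finsetSum_apply, Finsupp.single_apply]

theorem sum_charFinsupp [DecidableEq V] (K W : Finset V) :
    ∑ v ∈ K, charFinsupp W v = (K ∩ W).card := by
  simp [charFinsupp_apply]

theorem sum_multiset_charFinsupp [DecidableEq V] (K : Finset V) (F : Multiset (Finset V)) :
    ∑ v ∈ K, (F.map charFinsupp).sum v = (F.map fun W => (K ∩ W).card).sum := by
  induction F using Multiset.induction_on with
  | empty => simp
  | cons W F ih => simp [Finset.sum_add_distrib, ih, sum_charFinsupp]

theorem sum_mul_multiset_charFinsupp [Fintype V] (b : V → ℕ) (F : Multiset (Finset V)) :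
    ∑ v, b v * (F.map charFinsupp).sum v = (F.map fun W => ∑ v ∈ W, b v).sum := by
  classical
  induction F using Multiset.induction_on with
  | empty => simp
  | cons W F ih => simp [Finset.sum_add_distrib, mul_add, ih, charFinsupp_apply]

theorem exists_mem_of_sum_charFinsupp_ne_zero {F : Multiset (Finset V)} {v : V}
    (h : (F.map charFinsupp).sum v ≠ 0) : ∃ W ∈ F, v ∈ W := by
  classical
  induction F using Multiset.induction_on with
  | empty => simp at h
  | cons W F ih =>
    by_cases hv : v ∈ W
    · exact ⟨W, by simp, hv⟩
    · obtain ⟨T, hT, hvT⟩ := ih (by simpa [charFinsupp_apply, hv] using h)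
      exact ⟨T, by simp [hT], hvT⟩

/-- The weight `a` is a sum of the indicators of at most `n` cliques. -/
def HasCliqueCover (G : SimpleGraph V) (a : V →₀ ℕ) (n : ℕ) : Prop :=
  ∃ F : Multiset (Finset V), F.card ≤ n ∧ (∀ W ∈ F, G.IsClique (W : Set V)) ∧
    (F.map charFinsupp).sum = a

/-- For every weight, the largest weight of an independent set bounds the least number of cliques
needed to cover that weight. -/
def IsWeightedCliquePerfect (G : SimpleGraph V) : Prop :=
  ∀ (a : V →₀ ℕ) (n : ℕ),
    (∀ S : Finset V, Gᶜ.IsClique (S : Set V) → ∑ v ∈ S, a v ≤ n) → G.HasCliqueCover a n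

theorem HasCliqueCover.cons {G : SimpleGraph V} {a : V →₀ ℕ} {n : ℕ} (h : G.HasCliqueCover a n)
    {W : Finset V} (hW : G.IsClique (W : Set V)) :
    G.HasCliqueCover (charFinsupp W + a) (n + 1) := by
  obtain ⟨F, hn, hF, rfl⟩ := h
  refine ⟨W ::ₘ F, by simpa using hn, ?_, by simp⟩
  simpa [hW] using hF

theorem card_inter_le_one_of_isClique [DecidableEq V] {G : SimpleGraph V} {K T : Finset V}
    (hK : G.IsClique (K : Set V)) (hT : Gᶜ.IsClique (T : Set V)) : (K ∩ T).card ≤ 1 := by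
  rw [Finset.card_le_one]
  intro x hx y hy
  by_contra hne
  rw [Finset.mem_inter] at hx hy
  have h1 := hK hx.1 hy.1 hne
  have h2 := hT hx.2 hy.2 hne
  exact h2.2 h1

/-- Replication by induction on total weight. A 0/1 weight is covered by colouring its support; a
weight with some `a v ≥ 2` is lowered by one at `v`, and the resulting cover is repaired. -/
theorem IsPerfect.isWeightedCliquePerfect_compl [Fintype V] {G : SimpleGraph V}
    (hG : G.IsPerfect) : Gᶜ.IsWeightedCliquePerfect := by
  classical
  intro a n ha
  rw [compl_compl] at ha
  induction hN : ∑ v, a v using Nat.strong_induction_on generalizing a n with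
  | _ N ih =>
  subst hN
  by_cases h : ∃ v, 2 ≤ a v
  · obtain ⟨v, hv⟩ := h
    obtain ⟨b, rfl⟩ : ∃ b : V →₀ ℕ, a = b + Finsupp.single v 1 := by
      refine ⟨a - Finsupp.single v 1, (tsub_add_cancel_of_le ?_).symm⟩
      rw [Finsupp.single_le_iff]; omega
    have hbv : b v ≠ 0 := by
      simp only [Finsupp.add_apply, Finsupp.single_eq_same] at hv; omega
    have hsum : ∀ c : V →₀ ℕ, ∀ K : Finset V, ∑ x ∈ K, (c + Finsupp.single v 1 : V →₀ ℕ) x =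
        ∑ x ∈ K, c x + if v ∈ K then 1 else 0 := by
      intro c K
      simp [Finset.sum_add_distrib, Finsupp.single_apply]
    simp only [hsum] at ih ha
    obtain ⟨F, hFn, hF, hFb⟩ := ih (∑ x, b x) (by simp) b n
      (fun S hS => le_trans (Nat.le_add_right _ _) (ha S hS)) rfl
    rcases hFn.lt_or_eq with hlt | heq
    · refine ⟨{v} ::ₘ F, by simpa using hlt, by simpa using hF, ?_⟩
      simp [charFinsupp, hFb, add_comm]
    -- All `n` sets are used, so trade an independent set `T` through `v` for a better cover of the
    -- rest plus `v`. Cliques through `v` lose weight by meeting `T`; the others meet each of the `n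
    -- - 1` remaining sets at most once.
    · obtain ⟨T, hT, hvT⟩ := exists_mem_of_sum_charFinsupp_ne_zero (hFb.symm ▸ hbv)
      obtain ⟨F, rfl⟩ := Multiset.exists_cons_of_mem hT
      have hTG := hF T hT
      set c : V →₀ ℕ := (F.map charFinsupp).sum with hc
      have hbc : b = charFinsupp T + c := by simpa using hFb.symm
      have hFcard : F.card + 1 = n := by simpa using heq
      have hcov : Gᶜ.HasCliqueCover (c + Finsupp.single v 1) F.card := by
        refine ih _ ?_ _ _ ?_ rfl
        · have h1 : ∑ x, b x = (Finset.univ ∩ T).card + ∑ x, c x := by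
            rw [hbc, ← sum_charFinsupp, ← Finset.sum_add_distrib]; rfl
          have h2 : 0 < (Finset.univ ∩ T).card :=
            Finset.card_pos.mpr ⟨v, by simpa using hvT⟩
          simp only [hsum, Finset.mem_univ, if_true]
          omega
        · intro K hK
          have h1 : ∑ x ∈ K, b x = (K ∩ T).card + ∑ x ∈ K, c x := by
            rw [hbc, ← sum_charFinsupp, ← Finset.sum_add_distrib]; rfl
          have h2 := ha K hK
          rw [hsum]
          by_cases hvK : v ∈ K
          · have h3 : 0 < (K ∩ T).card :=
              Finset.card_pos.mpr ⟨v, Finset.mem_inter.mpr ⟨hvK, hvT⟩⟩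
            simp only [hvK, if_true] at h2 ⊢
            omega
          · simp only [hvK, if_false, add_zero]
            rw [hc, sum_multiset_charFinsupp]
            refine (Multiset.sum_le_card_nsmul _ 1 ?_).trans (by simp)
            intro x hx
            obtain ⟨W, hW, rfl⟩ := Multiset.mem_map.mp hx
            exact card_inter_le_one_of_isClique hK (hF W (Multiset.mem_cons_of_mem hW))
      have := hcov.cons hTG
      rwa [hFcard, ← add_assoc, ← hbc] at this
  · push Not at h
    set W : Set V := {v | a v ≠ 0} with hW
    have hle : (G.induce W).cliqueNum ≤ n := by
      obtain ⟨s, hs⟩ := (G.induce W).exists_isNClique_cliqueNum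
      have hcl : G.IsClique ((s.map (Function.Embedding.subtype _) : Finset V) : Set V) := by
        intro x hx y hy hxy
        simp only [Finset.coe_map, Set.mem_image, Finset.mem_coe] at hx hy
        obtain ⟨x, hx, rfl⟩ := hx
        obtain ⟨y, hy, rfl⟩ := hy
        exact hs.1 hx hy (fun h => hxy (by rw [h]))
      refine le_trans ?_ (ha _ hcl)
      rw [← hs.2, Finset.sum_map, Finset.card_eq_sum_ones]
      exact Finset.sum_le_sum fun x _ => Nat.one_le_iff_ne_zero.mpr x.2
    have hcol : (G.induce W).Colorable n := by
      rw [← chromaticNumber_le_iff_colorable, ← hG W]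
      exact_mod_cast hle
    obtain ⟨C⟩ := hcol
    refine ⟨Finset.univ.val.map fun c : Fin n =>
      Finset.univ.filter fun v : V => ∃ hv : v ∈ W, C ⟨v, hv⟩ = c, by simp, ?_, ?_⟩
    · intro T hT
      obtain ⟨c, -, rfl⟩ := Multiset.mem_map.mp hT
      intro x hx y hy hxy
      simp only [Finset.coe_filter, Finset.mem_univ, true_and, Set.mem_ofPred_eq] at hx hy
      obtain ⟨hx, hxc⟩ := hx
      obtain ⟨hy, hyc⟩ := hy
      refine (compl_adj ..).mpr ⟨hxy, fun hadj => ?_⟩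
      exact C.valid (v := ⟨x, hx⟩) (w := ⟨y, hy⟩) hadj (hxc.trans hyc.symm)
    · ext v
      rw [Multiset.map_map]
      change (∑ c : Fin n, charFinsupp (Finset.univ.filter fun v : V =>
        ∃ hv : v ∈ W, C ⟨v, hv⟩ = c)) v = _
      rw [Finsupp.finsetSum_apply]
      simp only [charFinsupp_apply, Finset.mem_filter, Finset.mem_univ, true_and]
      by_cases hv : v ∈ W
      · have h1 : a v = 1 := by
          have := h v
          have : a v ≠ 0 := hv
          omega
        simp [hv, h1]
      · have h0 : a v = 0 := by simpa [hW] using hv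
        simp [hv, h0]

/-- Induction on `n`: it suffices to find an independent set meeting every clique of maximal weight
`n + 1`, and to subtract it. -/
theorem IsWeightedCliquePerfect.compl [Fintype V] {G : SimpleGraph V}
    (hG : G.IsWeightedCliquePerfect) : Gᶜ.IsWeightedCliquePerfect := by
  classical
  intro a n ha
  rw [compl_compl] at ha
  induction n generalizing a with
  | zero =>
    refine ⟨0, by simp, by simp, ?_⟩
    ext v
    simpa [eq_comm] using ha {v} (by simp)
  | succ n ih =>
    obtain ⟨K, hK, hKS⟩ : ∃ K : Finset V, Gᶜ.IsClique (K : Set V) ∧ ∀ S : Finset V,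
        G.IsClique (S : Set V) → ∑ v ∈ S, a v = n + 1 → ¬ Disjoint K S := by
      by_contra! hcon
      have hcon' : ∀ K : Finset V, ∃ S : Finset V, Gᶜ.IsClique (K : Set V) →
          G.IsClique (S : Set V) ∧ ∑ v ∈ S, a v = n + 1 ∧ Disjoint K S := by
        intro K
        by_cases hK : Gᶜ.IsClique (K : Set V)
        · obtain ⟨S, hS⟩ := hcon K hK
          exact ⟨S, fun _ => hS⟩
        · exact ⟨∅, fun h => absurd h hK⟩
      choose S hS using hcon'
      set Ks : Finset (Finset V) := Finset.univ.filter fun K => Gᶜ.IsClique (K : Set V) with hKs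
      have hmem : ∀ K, K ∈ Ks ↔ Gᶜ.IsClique (K : Set V) := by simp [hKs]
      -- Each independent `K` misses its own clique `S K` and meets every other `S L` at most once,
      -- whence the bound `Ks.card - 1`. But that many cliques, of `a`-weight at most `n + 1` each,
      -- cannot carry the total `Ks.card * (n + 1)`.
      obtain ⟨F, hFn, hF, hFc⟩ := hG ((Ks.val.map S).map charFinsupp).sum
        (Ks.card - 1) <| by
          intro K hK
          rw [sum_multiset_charFinsupp, Multiset.map_map]
          change ∑ L ∈ Ks, (K ∩ S L).card ≤ _
          rw [← Finset.add_sum_erase _ _ ((hmem K).mpr hK),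
            Finset.disjoint_iff_inter_eq_empty.mp (hS K hK).2.2, Finset.card_empty, zero_add,
            ← Finset.card_erase_of_mem ((hmem K).mpr hK), Finset.card_eq_sum_ones]
          refine Finset.sum_le_sum fun L hL => ?_
          rw [Finset.inter_comm]
          exact card_inter_le_one_of_isClique
            (hS L ((hmem L).mp (Finset.mem_of_mem_erase hL))).1 hK
      have h1 := sum_mul_multiset_charFinsupp a F
      rw [hFc, sum_mul_multiset_charFinsupp, Multiset.map_map] at h1
      change ∑ L ∈ Ks, ∑ v ∈ S L, a v = _ at h1
      rw [Finset.sum_congr rfl fun L hL => (hS L ((hmem L).mp hL)).2.1, Finset.sum_const,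
        smul_eq_mul] at h1
      have h2 : (F.map fun W => ∑ v ∈ W, a v).sum ≤ F.card * (n + 1) := by
        refine (Multiset.sum_le_card_nsmul _ (n + 1) ?_).trans (by simp)
        intro x hx
        obtain ⟨W, hW, rfl⟩ := Multiset.mem_map.mp hx
        exact ha W (hF W hW)
      have h3 : 0 < Ks.card := Finset.card_pos.mpr ⟨∅, (hmem ∅).mpr (by simp)⟩
      have h4 : Ks.card ≤ F.card := Nat.le_of_mul_le_mul_right (h1.trans_le h2) (Nat.succ_pos n)
      omega
    -- Restricting to the support makes the truncated subtraction exact.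
    set L : Finset V := K.filter fun v => a v ≠ 0 with hL
    have hLa : charFinsupp L ≤ a := by
      intro v
      rw [charFinsupp_apply]
      split_ifs with hv
      · exact Nat.one_le_iff_ne_zero.mpr (Finset.mem_filter.mp hv).2
      · exact Nat.zero_le _
    have hcov := ih (a - charFinsupp L) fun S hS => by
      have hle : ∑ v ∈ S, (a - charFinsupp L) v ≤ ∑ v ∈ S, a v :=
        Finset.sum_le_sum fun v _ => by simp
      rcases (ha S hS).lt_or_eq with hlt | heq
      · omega
      · have hS' : G.IsClique ((S.filter fun v => a v ≠ 0 : Finset V) : Set V) :=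
          hS.subset (by exact_mod_cast Finset.filter_subset _ _)
        obtain ⟨x, hxK, hxS⟩ := Finset.not_disjoint_iff.mp
          (hKS _ hS' (by rw [Finset.sum_filter_ne_zero, heq]))
        rw [Finset.mem_filter] at hxS
        have hxL : x ∈ L := Finset.mem_filter.mpr ⟨hxK, hxS.2⟩
        have hlt : ∑ v ∈ S, (a - charFinsupp L) v < ∑ v ∈ S, a v := by
          refine Finset.sum_lt_sum (fun v _ => by simp) ⟨x, hxS.1, ?_⟩
          simp only [Finsupp.tsub_apply, charFinsupp_apply, hxL, if_true]
          have := hxS.2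
          omega
        omega
    have := hcov.cons (W := L) (hK.subset (by exact_mod_cast Finset.filter_subset _ _))
    rwa [add_tsub_cancel_of_le hLa] at this

theorem IsWeightedCliquePerfect.isPerfect_of_compl [Fintype V] {G : SimpleGraph V}
    (hG : Gᶜ.IsWeightedCliquePerfect) : G.IsPerfect := by
  classical
  intro W
  refine le_antisymm (G.induce W).cliqueNum_le_chromaticNumber ?_
  rw [chromaticNumber_le_iff_colorable]
  obtain ⟨F, hFn, hF, hFW⟩ := hG (charFinsupp W.toFinset) (G.induce W).cliqueNum <| by
    intro S hS
    rw [compl_compl] at hS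
    rw [sum_charFinsupp]
    have hcl : (G.induce W).IsClique ((S.subtype (· ∈ W) : Finset W) : Set W) := by
      intro x hx y hy hxy
      simp only [Finset.mem_coe, Finset.mem_subtype] at hx hy
      exact hS hx hy (fun h => hxy (Subtype.ext h))
    refine le_trans (le_of_eq ?_) hcl.card_le_cliqueNum
    rw [Finset.card_subtype]
    congr 1
    ext x
    simp
  have hex : ∀ v : W, ∃ T ∈ F, (v : V) ∈ T := fun v =>
    exists_mem_of_sum_charFinsupp_ne_zero (by rw [hFW, charFinsupp_apply]; simp)
  choose T hT hvT using hex
  let C : (G.induce W).Coloring F.toFinset := Coloring.mk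
    (fun v => ⟨T v, Multiset.mem_toFinset.mpr (hT v)⟩) fun {v w} hvw heq => by
      have heq' : T v = T w := congrArg Subtype.val heq
      have hne : (v : V) ≠ w := fun h => hvw.ne (Subtype.ext h)
      exact (hF _ (hT v) (hvT v) (heq' ▸ hvT w) hne).2 hvw
  refine C.colorable.mono ?_
  rw [Fintype.card_coe]
  exact (Multiset.toFinset_card_le F).trans hFn

end SimpleGraph

/-! ### Symbolic powers of the edge ideal via vertex covers. -/

namespace SimpleGraph

open MvPolynomial

variable {V : Type*} (K : Type*) [Field K]

section CoverPrime

variable [DecidableEq V]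

/-- The homomorphism multiplying the variables in `C` by a new variable, which records the degree
in the variables of `C`. -/
noncomputable def coverHom (C : Finset V) :
    MvPolynomial V K →ₐ[K] Polynomial (MvPolynomial V K) :=
  aeval fun i => Polynomial.C (X i) * if i ∈ C then Polynomial.X else 1

variable {K}

theorem coverHom_monomial [Fintype V] (C : Finset V) (a : V →₀ ℕ) (c : K) :
    coverHom K C (monomial a c) = Polynomial.monomial (∑ i ∈ C, a i) (monomial a c) := by
  rw [coverHom, aeval_monomial, Finsupp.prod_fintype _ _ (by simp),
    ← Polynomial.C_mul_X_pow_eq_monomial]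
  simp_rw [mul_pow]
  rw [Finset.prod_mul_distrib, ← mul_assoc]
  congr 1
  · rw [monomial_eq, Finsupp.prod_fintype _ _ (by simp), map_mul, map_prod]
    simp [Polynomial.algebraMap_apply, algebraMap_eq]
  · simp [ite_pow, Finset.prod_ite_mem, Finset.prod_pow_eq_pow_sum]

theorem coeff_coeff_coverHom [Fintype V] (C : Finset V) (f : MvPolynomial V K) (d : ℕ)
    (a : V →₀ ℕ) :
    ((coverHom K C f).coeff d).coeff a = if ∑ i ∈ C, a i = d then f.coeff a else 0 := by
  induction f using MvPolynomial.induction_on' with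
  | monomial b c =>
    rw [coverHom_monomial, Polynomial.coeff_monomial]
    by_cases hab : b = a
    · subst hab; split_ifs <;> simp
    · split_ifs <;> simp [coeff_monomial, hab]
  | add p q hp hq =>
    rw [map_add, Polynomial.coeff_add, coeff_add, hp, hq, coeff_add]
    split_ifs <;> simp

theorem X_pow_dvd_coverHom_iff [Fintype V] (C : Finset V) (f : MvPolynomial V K) (r : ℕ) :
    Polynomial.X ^ r ∣ coverHom K C f ↔ ∀ a ∈ f.support, r ≤ ∑ i ∈ C, a i := by
  rw [Polynomial.X_pow_dvd_iff]
  constructor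
  · intro h a ha
    by_contra! hlt
    have := coeff_coeff_coverHom C f (∑ i ∈ C, a i) a
    rw [h _ hlt, if_pos rfl, coeff_zero] at this
    exact mem_support_iff.mp ha this.symm
  · intro h d hd
    ext a
    rw [coeff_coeff_coverHom, coeff_zero]
    split_ifs with had
    · by_contra hne
      have := h a (mem_support_iff.mpr hne)
      omega
    · rfl

variable (K) in
/-- The prime ideal generated by the variables in `C`. -/
noncomputable def coverPrime (C : Finset V) : Ideal (MvPolynomial V K) :=
  (Ideal.span {Polynomial.X}).comap (coverHom K C)

/-- Immediate from the definition as a preimage; generation by variables is then recovered in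
`coverPrime_le`. -/
instance coverPrime_isPrime (C : Finset V) : (coverPrime K C).IsPrime := by
  have : (Ideal.span {(Polynomial.X : Polynomial (MvPolynomial V K))}).IsPrime :=
    (Ideal.span_singleton_prime Polynomial.X_ne_zero).mpr Polynomial.prime_X
  exact Ideal.IsPrime.comap _

theorem mem_coverPrime_iff_dvd {C : Finset V} {f : MvPolynomial V K} :
    f ∈ coverPrime K C ↔ Polynomial.X ∣ coverHom K C f := by
  rw [coverPrime, Ideal.mem_comap, Ideal.mem_span_singleton]

theorem mem_coverPrime_iff [Fintype V] {C : Finset V} {f : MvPolynomial V K} :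
    f ∈ coverPrime K C ↔ ∀ a ∈ f.support, 1 ≤ ∑ i ∈ C, a i := by
  rw [mem_coverPrime_iff_dvd, ← X_pow_dvd_coverHom_iff, pow_one]

theorem X_mem_coverPrime_iff [Fintype V] {C : Finset V} {i : V} :
    (X i : MvPolynomial V K) ∈ coverPrime K C ↔ i ∈ C := by
  rw [mem_coverPrime_iff, support_X]
  simp [Finsupp.single_apply, Nat.one_le_iff_ne_zero]

theorem coverPrime_le [Fintype V] {C : Finset V} {Q : Ideal (MvPolynomial V K)}
    (h : ∀ i ∈ C, X i ∈ Q) : coverPrime K C ≤ Q := by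
  intro f hf
  rw [mem_coverPrime_iff] at hf
  rw [f.as_sum]
  refine Ideal.sum_mem _ fun a ha => ?_
  obtain ⟨i, hi, hai⟩ := Finset.exists_ne_zero_of_sum_ne_zero (Nat.one_le_iff_ne_zero.mp (hf a ha))
  refine Q.mem_of_dvd ?_ (h i hi)
  rw [X, monomial_dvd_monomial]
  exact ⟨Or.inr (Finsupp.single_le_iff.mpr (Nat.one_le_iff_ne_zero.mpr hai)), one_dvd _⟩

end CoverPrime

variable {K}

theorem isVertexCover_of_edgeIdeal_le {G : SimpleGraph V} {Q : Ideal (MvPolynomial V K)}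
    [hQ : Q.IsPrime] (h : G.edgeIdeal K ≤ Q) {C : Finset V} (hC : ∀ i, i ∈ C ↔ X i ∈ Q) :
    G.IsVertexCover ↑C := by
  intro i j hij
  rw [Finset.mem_coe, Finset.mem_coe, hC, hC]
  exact hQ.mem_or_mem (h (Ideal.subset_span ⟨i, j, hij, rfl⟩))

theorem IsVertexCover.edgeIdeal_le [Fintype V] [DecidableEq V] {G : SimpleGraph V} {C : Finset V}
    (hC : G.IsVertexCover ↑C) : G.edgeIdeal K ≤ coverPrime K C := by
  refine Ideal.span_le.mpr ?_
  rintro _ ⟨i, j, hij, rfl⟩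
  rcases hC hij with h | h
  · exact Ideal.mul_mem_right _ _ (X_mem_coverPrime_iff.mpr h)
  · exact Ideal.mul_mem_left _ _ (X_mem_coverPrime_iff.mpr h)

/-- The variables in `Q` form a cover whose prime lies below `Q`. A vertex with no neighbour outside
could be erased, contradicting minimality. -/
theorem exists_eq_coverPrime_of_mem_minimalPrimes [Fintype V] [DecidableEq V] {G : SimpleGraph V}
    {Q : Ideal (MvPolynomial V K)} (hQ : Q ∈ (G.edgeIdeal K).minimalPrimes) :
    ∃ C : Finset V, Q = coverPrime K C ∧ G.IsVertexCover ↑C ∧ ∀ i ∈ C, ∃ j ∉ C, G.Adj i j := by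
  classical
  have := hQ.1.1
  set C : Finset V := Finset.univ.filter fun i => X i ∈ Q with hC
  have hmem : ∀ i, i ∈ C ↔ X i ∈ Q := by simp [hC]
  have hcov : G.IsVertexCover ↑C := isVertexCover_of_edgeIdeal_le hQ.1.2 hmem
  have hmin : ∀ D : Finset V, G.IsVertexCover ↑D → D ⊆ C → Q ≤ coverPrime K D := fun D hD hDC =>
    hQ.2 ⟨coverPrime_isPrime D, hD.edgeIdeal_le⟩
      (coverPrime_le fun i hi => (hmem i).mp (hDC hi))
  refine ⟨C, le_antisymm (hmin C hcov subset_rfl) (coverPrime_le fun i hi => (hmem i).mp hi),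
    hcov, ?_⟩
  intro i hi
  by_contra! hcon
  have hcov' : G.IsVertexCover ↑(C.erase i) := by
    intro k l hkl
    rw [Finset.mem_coe, Finset.mem_coe, Finset.mem_erase, Finset.mem_erase]
    by_cases hk : k = i
    · subst hk
      exact Or.inr ⟨hkl.ne', by_contra fun hl => hcon l hl hkl⟩
    · by_cases hl : l = i
      · subst hl
        exact Or.inl ⟨hk, by_contra fun hk' => hcon k hk' hkl.symm⟩
      · exact (hcov hkl).imp (fun h => ⟨hk, h⟩) (fun h => ⟨hl, h⟩)
  have := X_mem_coverPrime_iff.mp (hmin _ hcov' (Finset.erase_subset _ _) ((hmem i).mp hi))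
  simp at this

theorem _root_.Ideal.mem_symbolicPower_iff {R : Type*} [CommRing R] {I : Ideal R} {r : ℕ} {f : R} :
    f ∈ I.symbolicPower r ↔ ∃ s ∈ I.minimalPrimesCompl, s * f ∈ I ^ r := by
  rw [Ideal.symbolicPower, Ideal.mem_comap,
    IsLocalization.algebraMap_mem_map_algebraMap_iff I.minimalPrimesCompl]

theorem le_sum_of_mem_symbolicPower [Fintype V] {G : SimpleGraph V} {r : ℕ}
    {f : MvPolynomial V K} (hf : f ∈ (G.edgeIdeal K).symbolicPower r) {a : V →₀ ℕ}
    (ha : a ∈ f.support) {C : Finset V} (hC : G.IsVertexCover ↑C) : r ≤ ∑ i ∈ C, a i := by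
  classical
  obtain ⟨s, hs, hsf⟩ := Ideal.mem_symbolicPower_iff.mp hf
  obtain ⟨Q, hQ, hQC⟩ := Ideal.exists_minimalPrimes_le (hC.edgeIdeal_le (K := K))
  obtain ⟨D, rfl, hD, -⟩ := exists_eq_coverPrime_of_mem_minimalPrimes hQ
  have hDC : D ⊆ C := fun i hi =>
    X_mem_coverPrime_iff.mp (hQC (X_mem_coverPrime_iff.mpr hi))
  have hsD := hs _ hQ
  rw [mem_coverPrime_iff_dvd] at hsD
  have hpow : coverHom K D (s * f) ∈ Ideal.span {Polynomial.X ^ r} := by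
    rw [← Ideal.span_singleton_pow, ← Ideal.mem_comap]
    exact Ideal.le_comap_pow _ _ (Ideal.pow_right_mono hD.edgeIdeal_le r hsf)
  rw [Ideal.mem_span_singleton, map_mul] at hpow
  -- The new variable is prime and does not divide the image of `s`, so the whole power divides the
  -- image of `f`.
  have := Polynomial.prime_X.pow_dvd_of_dvd_mul_left r hsD hpow
  exact ((X_pow_dvd_coverHom_iff D f r).mp this a ha).trans
    (Finset.sum_le_sum_of_subset hDC)

/-- By prime avoidance it is enough that the colon ideal `J` lies in no single minimal prime. -/
theorem monomial_mem_symbolicPower [Fintype V] {G : SimpleGraph V} {r : ℕ} {a : V →₀ ℕ}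
    (h : ∀ C : Finset V, G.IsVertexCover ↑C → r ≤ ∑ i ∈ C, a i) :
    monomial a (1 : K) ∈ (G.edgeIdeal K).symbolicPower r := by
  classical
  rw [Ideal.mem_symbolicPower_iff]
  by_contra! hcon
  set J : Ideal (MvPolynomial V K) :=
    Submodule.comap (LinearMap.mulRight (MvPolynomial V K) (monomial a (1 : K)))
      (G.edgeIdeal K ^ r)
  have hfin := (G.edgeIdeal K).finite_minimalPrimes_of_isNoetherianRing (MvPolynomial V K)
  have hsub : (J : Set (MvPolynomial V K)) ⊆ ⋃ Q ∈ (hfin.toFinset : Set (Ideal (MvPolynomial V K))),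
      (Q : Set (MvPolynomial V K)) := by
    intro s hs
    by_contra hsQ
    refine hcon s (fun Q hQ hsQ' => hsQ ?_) hs
    simp only [Set.mem_iUnion]
    exact ⟨Q, by simpa using hQ, hsQ'⟩
  rw [Ideal.subset_union_prime (f := fun Q => Q) ⊤ ⊤ (by
    intro Q hQ _ _
    exact (hfin.mem_toFinset.mp hQ).1.1)] at hsub
  obtain ⟨Q, hQ, hJQ⟩ := hsub
  obtain ⟨C, rfl, hC, hnb⟩ :=
    exists_eq_coverPrime_of_mem_minimalPrimes (hfin.mem_toFinset.mp hQ)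
  choose! g hgC hg using hnb
  -- Each factor `X i` with `i ∈ C` is paired with a neighbour outside `C`, giving `∑ i ∈ C, a i ≥
  -- r` edges; the multiplier avoids all variables of `C`.
  have hmem : ∏ i ∈ C, (X (g i) : MvPolynomial V K) ^ a i ∈ J := by
    change _ * monomial a (1 : K) ∈ G.edgeIdeal K ^ r
    rw [monomial_eq, Finsupp.prod_fintype _ _ (by simp), C_1, one_mul,
      ← Finset.prod_mul_prod_compl C, ← mul_assoc, ← Finset.prod_mul_distrib]
    refine Ideal.mul_mem_right _ _ (Ideal.pow_le_pow_right (h C hC) ?_)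
    rw [← Finset.prod_pow_eq_pow_sum]
    refine Ideal.prod_mem_prod fun i hi => ?_
    rw [← mul_pow]
    have hedge : (X (g i) * X i : MvPolynomial V K) ∈ G.edgeIdeal K :=
      Ideal.subset_span ⟨g i, i, (hg i hi).symm, rfl⟩
    exact Ideal.pow_mem_pow hedge _
  obtain ⟨i, hi, hmem'⟩ := (Ideal.IsPrime.prod_mem_iff).mp (hJQ hmem)
  exact hgC i hi (X_mem_coverPrime_iff.mp ((coverPrime_isPrime C).mem_of_pow_mem _ hmem'))

end SimpleGraph

/-! ### Clique packings and membership in the clique ideal. -/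

namespace SimpleGraph

open MvPolynomial

variable {V : Type*}

theorem HasCliqueCover.add {G : SimpleGraph V} {a b : V →₀ ℕ} {m n : ℕ}
    (ha : G.HasCliqueCover a m) (hb : G.HasCliqueCover b n) : G.HasCliqueCover (a + b) (m + n) := by
  obtain ⟨F, hm, hF, rfl⟩ := ha
  obtain ⟨F', hn, hF', rfl⟩ := hb
  refine ⟨F + F', by simpa using add_le_add hm hn, ?_, by simp⟩
  intro W hW
  exact (Multiset.mem_add.mp hW).elim (hF W) (hF' W)

theorem HasCliqueCover.mono {G : SimpleGraph V} {a : V →₀ ℕ} {m n : ℕ}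
    (ha : G.HasCliqueCover a m) (hmn : m ≤ n) : G.HasCliqueCover a n := by
  obtain ⟨F, hm, hF⟩ := ha
  exact ⟨F, hm.trans hmn, hF⟩

theorem hasCliqueCover_sum [Fintype V] (G : SimpleGraph V) (a : V →₀ ℕ) :
    G.HasCliqueCover a (∑ v, a v) := by
  classical
  induction a using Finsupp.induction_linear with
  | zero => exact ⟨0, by simp, by simp, by simp⟩
  | add f g hf hg => simpa [Finset.sum_add_distrib] using hf.add hg
  | single v n =>
    refine ⟨Multiset.replicate n {v}, by simp [Finsupp.single_apply], ?_, ?_⟩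
    · intro W hW
      rw [Multiset.eq_of_mem_replicate hW]
      simp
    · simp [charFinsupp]

/-- The monomial with exponent `a` is divisible by a product of clique monomials of the kind that
generates `G.cliqueProductIdeal K r`. -/
def HasCliquePacking (G : SimpleGraph V) (a : V →₀ ℕ) (r : ℕ) : Prop :=
  ∃ F : Multiset (Finset V), (∀ W ∈ F, G.IsClique (W : Set V) ∧ 2 ≤ W.card) ∧
    (F.map fun W => W.card - 1).sum = r ∧ (F.map charFinsupp).sum ≤ a

theorem hasCliquePacking_of_le {G : SimpleGraph V} {F : Multiset (Finset V)}
    (hF : ∀ W ∈ F, G.IsClique (W : Set V)) {r : ℕ}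
    (hr : r ≤ (F.map fun W => W.card - 1).sum) :
    G.HasCliquePacking (F.map charFinsupp).sum r := by
  classical
  induction F using Multiset.induction_on generalizing r with
  | empty =>
    obtain rfl : r = 0 := by simpa using hr
    exact ⟨0, by simp, by simp, by simp⟩
  | cons W F ih =>
    have hF' : ∀ T ∈ F, G.IsClique (T : Set V) := fun T hT => hF T (Multiset.mem_cons_of_mem hT)
    simp only [Multiset.map_cons, Multiset.sum_cons] at hr ⊢
    rcases le_or_gt r (F.map fun W => W.card - 1).sum with hle | hlt
    · obtain ⟨E, hE, hEr, hEa⟩ := ih hF' hle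
      exact ⟨E, hE, hEr, hEa.trans le_add_self⟩
    · obtain ⟨E, hE, hEr, hEa⟩ := ih hF' le_rfl
      -- Shrink `W` so that `T.card - 1` is exactly the missing degree.
      obtain ⟨T, hTW, hT⟩ := Finset.exists_subset_card_eq
        (show r - (F.map fun W => W.card - 1).sum + 1 ≤ W.card by omega)
      refine ⟨T ::ₘ E, ?_, ?_, ?_⟩
      · simp only [Multiset.mem_cons, forall_eq_or_imp]
        exact ⟨⟨(hF W (Multiset.mem_cons_self _ _)).subset (by exact_mod_cast hTW), by omega⟩, hE⟩
      · simp only [Multiset.map_cons, Multiset.sum_cons]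
        omega
      · simp only [Multiset.map_cons, Multiset.sum_cons]
        exact add_le_add (Finset.sum_le_sum_of_subset hTW) hEa

theorem sum_univ_multiset_charFinsupp [Fintype V] (F : Multiset (Finset V)) :
    ∑ v, (F.map charFinsupp).sum v = (F.map Finset.card).sum := by
  classical
  simp [sum_multiset_charFinsupp]

theorem HasCliqueCover.hasCliquePacking [Fintype V] {G : SimpleGraph V} {a : V →₀ ℕ} {n r : ℕ}
    (ha : G.HasCliqueCover a n) (hr : r + n ≤ ∑ v, a v) : G.HasCliquePacking a r := by
  obtain ⟨F, hn, hF, rfl⟩ := ha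
  refine hasCliquePacking_of_le hF ?_
  -- Only an inequality, as the cover may contain empty cliques.
  have : (F.map Finset.card).sum ≤ (F.map fun W => W.card - 1).sum + F.card := by
    clear hn hF hr
    induction F using Multiset.induction_on with
    | empty => simp
    | cons W F ih =>
      simp only [Multiset.map_cons, Multiset.sum_cons, Multiset.card_cons]
      omega
  rw [sum_univ_multiset_charFinsupp] at hr
  omega

/-- The packing uses weight `r + F.card`; covering the rest by singletons gives `|a| - r` cliques in
all. -/
theorem HasCliquePacking.hasCliqueCover [Fintype V] {G : SimpleGraph V} {a : V →₀ ℕ} {r : ℕ}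
    (ha : G.HasCliquePacking a r) : G.HasCliqueCover a (∑ v, a v - r) := by
  obtain ⟨F, hF, hr, hFa⟩ := ha
  have hcard : (F.map Finset.card).sum = r + F.card := by
    clear hFa
    induction F using Multiset.induction_on generalizing r with
    | empty => simpa using hr
    | cons W F ih =>
      have h1 := ih (fun T hT => hF T (Multiset.mem_cons_of_mem hT)) rfl
      have h2 := (hF W (Multiset.mem_cons_self _ _)).2
      simp only [Multiset.map_cons, Multiset.sum_cons, Multiset.card_cons] at hr ⊢
      omega
  obtain ⟨b, rfl⟩ := exists_add_of_le hFa
  have hcov : G.HasCliqueCover (F.map charFinsupp).sum F.card :=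
    ⟨F, le_rfl, fun W hW => (hF W hW).1, rfl⟩
  refine (hcov.add (G.hasCliqueCover_sum b)).mono ?_
  have : ∑ v, ((F.map charFinsupp).sum + b) v = (F.map Finset.card).sum + ∑ v, b v := by
    rw [← sum_univ_multiset_charFinsupp, ← Finset.sum_add_distrib]; rfl
  omega

variable {K : Type*} [Field K]

theorem prod_setMonomial (F : Multiset (Finset V)) :
    (F.map (setMonomial K)).prod = monomial (F.map charFinsupp).sum 1 := by
  induction F using Multiset.induction_on with
  | empty => simp
  | cons W F ih =>
    have hW : setMonomial K W = monomial (charFinsupp W) 1 := by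
      rw [setMonomial, charFinsupp, monomial_sum_one]
      rfl
    simp [ih, hW, monomial_mul]

theorem mem_cliqueProductIdeal_iff {G : SimpleGraph V} {r : ℕ} {f : MvPolynomial V K} :
    f ∈ G.cliqueProductIdeal K r ↔ ∀ a ∈ f.support, G.HasCliquePacking a r := by
  have : G.cliqueProductIdeal K r = Ideal.span ((fun s => monomial s (1 : K)) ''
      {s | ∃ F : Multiset (Finset V), (∀ W ∈ F, G.IsClique (W : Set V) ∧ 2 ≤ W.card) ∧
        (F.map fun W => W.card - 1).sum = r ∧ (F.map charFinsupp).sum = s}) := by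
    rw [cliqueProductIdeal]
    congr 1
    ext m
    constructor
    · rintro ⟨F, hF, hr, rfl⟩
      exact ⟨_, ⟨F, hF, hr, rfl⟩, (prod_setMonomial F).symm⟩
    · rintro ⟨_, ⟨F, hF, hr, rfl⟩, rfl⟩
      exact ⟨F, hF, hr, (prod_setMonomial F).symm⟩
  rw [this, mem_ideal_span_monomial_image]
  refine forall₂_congr fun a _ => ?_
  constructor
  · rintro ⟨_, ⟨F, hF, hr, rfl⟩, hle⟩
    exact ⟨F, hF, hr, hle⟩
  · rintro ⟨F, hF, hr, hle⟩
    exact ⟨_, ⟨F, hF, hr, rfl⟩, hle⟩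

theorem IsClique.compl_isVertexCover [Fintype V] [DecidableEq V] {G : SimpleGraph V} {S : Finset V}
    (hS : Gᶜ.IsClique (S : Set V)) : G.IsVertexCover ↑(Sᶜ) := by
  intro i j hij
  by_contra! h
  simp only [Finset.mem_coe, Finset.mem_compl, not_not] at h
  exact (hS h.1 h.2 hij.ne).2 hij

theorem IsVertexCover.isClique_compl [Fintype V] [DecidableEq V] {G : SimpleGraph V} {C : Finset V}
    (hC : G.IsVertexCover ↑C) : Gᶜ.IsClique ((Cᶜ : Finset V) : Set V) := by
  intro i hi j hj hij
  refine (compl_adj ..).mpr ⟨hij, fun hadj => ?_⟩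
  rw [Finset.mem_coe, Finset.mem_compl] at hi hj
  exact (hC hadj).elim hi hj

/-- A clique has at most one vertex outside a vertex cover. Perfection plays no role here. -/
theorem cliqueProductIdeal_le_symbolicPower [Fintype V] (G : SimpleGraph V) (r : ℕ) :
    G.cliqueProductIdeal K r ≤ (G.edgeIdeal K).symbolicPower r := by
  classical
  refine Ideal.span_le.mpr ?_
  rintro _ ⟨F, hF, rfl, rfl⟩
  rw [prod_setMonomial]
  refine monomial_mem_symbolicPower fun C hC => ?_
  rw [sum_multiset_charFinsupp]
  refine Multiset.sum_map_le_sum_map _ _ fun W hW => ?_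
  have h1 := card_inter_le_one_of_isClique (hF W hW).1 hC.isClique_compl
  have h2 := Finset.card_inter_add_card_sdiff W C
  rw [Finset.sdiff_eq_inter_compl] at h2
  rw [Finset.inter_comm]
  omega

end SimpleGraph

theorem mainTheorem2 {K : Type*} [Field K] {V : Type*} [Finite V] (G : SimpleGraph V) :
    G.IsPerfect ↔
      ∀ r : ℕ, (G.edgeIdeal K).symbolicPower r = G.cliqueProductIdeal K r := by
  classical
  cases nonempty_fintype V
  constructor
  · intro hG r
    refine le_antisymm (fun f hf => ?_) (G.cliqueProductIdeal_le_symbolicPower r)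
    rw [SimpleGraph.mem_cliqueProductIdeal_iff]
    intro a ha
    have hWP := hG.isWeightedCliquePerfect_compl.compl
    rw [compl_compl] at hWP
    have hcover : ∀ S : Finset V, Gᶜ.IsClique (S : Set V) → ∑ v ∈ S, a v + r ≤ ∑ v, a v := by
      intro S hS
      rw [← Finset.sum_add_sum_compl S]
      exact Nat.add_le_add_left
        (SimpleGraph.le_sum_of_mem_symbolicPower hf ha hS.compl_isVertexCover) _
    have hr : r ≤ ∑ v, a v := by simpa using hcover ∅ (by simp)
    exact (hWP a (∑ v, a v - r) fun S hS => Nat.le_sub_of_add_le (hcover S hS)).hasCliquePacking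
      (by omega)
  · intro h
    refine SimpleGraph.IsWeightedCliquePerfect.isPerfect_of_compl
      (SimpleGraph.IsWeightedCliquePerfect.compl ?_)
    intro a n ha
    -- If `n` exceeds the total weight, this exponent truncates to `0`, and the resulting bound
    -- `|a|` is still at most `n`.
    have hmem : MvPolynomial.monomial a (1 : K) ∈ G.cliqueProductIdeal K (∑ v, a v - n) := by
      rw [← h]
      refine SimpleGraph.monomial_mem_symbolicPower fun C hC => ?_
      have h1 := ha _ hC.isClique_compl
      have h2 := Finset.sum_add_sum_compl C a
      omega
    rw [SimpleGraph.mem_cliqueProductIdeal_iff] at hmem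
    refine (hmem a (by simp)).hasCliqueCover.mono (by omega)
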